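/- Let $\Omega\subset\mathbb{R}^N$ be a bounded open set with smooth boundary. Let $H:\overline\Omega\times\mathbb{R}^N\to[0,\infty)$ be a nondegenerate Finsler metric: $H$ is continuous, $H(x,\cdot)$ is convex with $H(x,tp)=tH(x,p)$ for $t\ge 0$, and $a|p|\le H(x,p)\le b|p|$ for some constants $a,b>0$. Let $H^*(x,q)=\sup\{\langle p,q\rangle: H(x,p)\le 1\}$ be its dual, and assume that $H^*(x,\cdot)\in C^1(\mathbb{R}^N\setminus\{0\})$ for every $x\in\overline\Omega$; write $\partial_\xi H^*$ for the gradient of $H^*$ in the second variable. Let $\phi,\psi\in C(\partial\Omega)$ and $\rho\in L^2(\Omega)$. *Tangential gradient.* For a finite positive Borel measure $\gamma$ on $\overline\Omega$, let $\mathcal{X}_\gamma(x)$ be the $\gamma$-essential union of the sets $\{\sigma(x)\}$ over all $\sigma\in L^1_\gamma(\overline\Omega;\mathbb{R}^N)$ for which $\operatorname{div}(\sigma\gamma)$ (in $\mathcal D'(\mathbb{R}^N)$) is a finite Radon measure on $\overline\Omega$, that is, the $\gamma$-a.e. smallest $\gamma$-measurable family of linear subspaces with $\sigma(x)\in\mathcal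 X_\gamma(x)$ for $\gamma$-a.e. $x$, for every such $\sigma$. For $w\in C^1(\overline\Omega)$, $\nabla_\gamma w(x)$ is the orthogonal projection of $\nabla w(x)$ onto $\mathcal{X}_\gamma(x)$. For Lipschitz $u$ on $\overline\Omega$, $\nabla_\gamma u\in L^\infty_\gamma$ is the weak-$*$ limit in $L^\infty_\gamma$ of $\nabla_\gamma w_n$ for equi-Lipschitz $w_n\in C^1(\overline\Omega)$ converging to $u$ uniformly on $\overline\Omega$. *Limiting PDE.* Let $u\in W^{1,\infty}(\Omega)$ (identified with its continuous representative on $\overline\Omega$) and let $\Theta$ be a finite $\mathbb{R}^N$-valued Radon measure on $\Omega$, with total variation $|\Theta|$ and density $\frac{\Theta}{|\Theta|}$. The pair $(u,\Theta)$ solves $$-\operatorname{div}\Theta=\rho\ \text{ in }\Omega,\qquad \Theta\cdot\nabla u=H(x,\Theta)\ \text{ in }\Omega,\qquad \phi\le u\le\psi\ \text{ on }\partial\Omega,$$ in the following sense: $\phi\le u\le\psi$ on $\partial\Omega$, and there is a finite signed Radon measure $\theta=\Theta\cdot\mathbf n$ on $\partial\Omega$ such that $$\int_\Omega \nabla\eta\cdot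 d\Theta=\int_\Omega\eta\rho\,dx+\int_{\partial\Omega}\eta\,d\theta\quad\text{for all }\eta\in C_c^\infty(\mathbb{R}^N),$$ the same identity holds for all $\eta\in W^{1,\infty}(\Omega)$ with $\nabla\eta$ replaced by $\nabla_{|\Theta|}\eta$, $$\frac{\Theta}{|\Theta|}\cdot\nabla_{|\Theta|}u=H\Big(x,\frac{\Theta}{|\Theta|}\Big)\quad|\Theta|\text{-a.e.},$$ $\operatorname{supp}\theta^+\subset\{x\in\partial\Omega:u=\phi\}$ and $\operatorname{supp}\theta^-\subset\{x\in\partial\Omega:u=\psi\}$. *Claim.* Let $(u,\Theta)$ be a solution of the limiting PDE in this sense, and let $\omega=H(x,\Theta)$ be the positive measure $H\big(x,\frac{\Theta}{|\Theta|}\big)|\Theta|$. If $H^*(x,\nabla_\omega u)\le 1$ for $\omega$-a.e. $x$, then $\partial_\xi H^*(x,\nabla_\omega u)$ is $\omega$-integrable, $$\Theta=\partial_\xi H^*(x,\nabla_\omega u)\,\omega\quad\text{as measures},\qquad\text{and}\qquad H^*(x,\nabla_\omega u)=1\quad\omega\text{-a.e.}$$ -/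

import Mathlib

open MeasureTheory Filter Set
open scoped Topology NNReal ENNReal InnerProductSpace

namespace Finsler

/-- The Euclidean space `ℝ^N`. -/
abbrev Euc (N : ℕ) : Type := EuclideanSpace ℝ (Fin N)

variable {N : ℕ}

/-! ### Domains and test functions -/

/-- `Ω` is a bounded open set with smooth boundary: near every boundary point it is the sublevel
set `{g < 0}` of a smooth function `g` that vanishes at the point and has no critical point. -/
structure IsSmoothBoundedDomain (Ω : Set (Euc N)) : Prop where
  isOpen : IsOpen Ω
  isBounded : Bornology.IsBounded Ω
  smooth_boundary : ∀ x ∈ frontier Ω, ∃ U : Set (Euc N), IsOpen U ∧ x ∈ U ∧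
    ∃ g : Euc N → ℝ, ContDiff ℝ (⊤ : ℕ∞) g ∧ g x = 0 ∧ (∀ y ∈ U, gradient g y ≠ 0) ∧
      Ω ∩ U = {y | g y < 0} ∩ U

/-- Test functions on the open set `U`: the space `𝓓(U)`. -/
structure IsTestFunction (U : Set (Euc N)) (η : Euc N → ℝ) : Prop where
  smooth : ContDiff ℝ (⊤ : ℕ∞) η
  compactSupport : HasCompactSupport η
  support_subset : tsupport η ⊆ U

/-- `u ∈ W^{1,∞}(Ω)`: `u` is essentially bounded with an essentially bounded weak gradient `g`. On a
smooth bounded domain such a function has a representative that is continuous on the closure, and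
it is this representative that `u` denotes. -/
structure MemW1Infty (Ω : Set (Euc N)) (u : Euc N → ℝ) : Prop where
  continuousOn : ContinuousOn u (closure Ω)
  memLp : MemLp u ∞ (volume.restrict Ω)
  weakGradient : ∃ g : Euc N → Euc N, MemLp g ∞ (volume.restrict Ω) ∧
    ∀ η : Euc N → ℝ, IsTestFunction Ω η →
      ∫ x in Ω, u x • gradient η x = - ∫ x in Ω, η x • g x

/-! ### Finsler metrics -/

/-- `H` is a nondegenerate Finsler metric on the closure of `Ω` (the values `H x p` with `x` outside
the closure are irrelevant). -/
structure IsNondegenerateFinsler (Ω : Set (Euc N)) (H : Euc N → Euc N → ℝ) : Prop where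
  continuousOn : ContinuousOn (fun z : Euc N × Euc N => H z.1 z.2) (closure Ω ×ˢ univ)
  nonneg : ∀ x ∈ closure Ω, ∀ p, 0 ≤ H x p
  convex : ∀ x ∈ closure Ω, ConvexOn ℝ univ (H x)
  homogeneous : ∀ x ∈ closure Ω, ∀ t : ℝ, 0 ≤ t → ∀ p, H x (t • p) = t * H x p
  nondegenerate : ∃ a b : ℝ, 0 < a ∧ 0 < b ∧
    ∀ x ∈ closure Ω, ∀ p, a * ‖p‖ ≤ H x p ∧ H x p ≤ b * ‖p‖

/-- The dual metric `H*(x, q) = sup {⟨p, q⟩ : H(x, p) ≤ 1}`. -/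
noncomputable def dual (H : Euc N → Euc N → ℝ) (x q : Euc N) : ℝ :=
  sSup {r : ℝ | ∃ p : Euc N, H x p ≤ 1 ∧ r = ⟪p, q⟫_ℝ}

/-! ### Vector valued measures

A bounded `ℝ^N`-valued Radon measure on `ℝ^N` is a countably additive Borel set function
`VectorMeasure (Euc N) (Euc N)`. Its total variation measure `|Θ|` is `Θ.variation`. -/

/-- The measure is carried by the set `K`. For Borel `K`, measures carried by `K` are the measures on
`K`, extended by zero. -/
def CarriedBy {M : Type*} [AddCommMonoid M] [TopologicalSpace M]
    (Θ : VectorMeasure (Euc N) M) (K : Set (Euc N)) : Prop :=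
  ∀ A : Set (Euc N), MeasurableSet A → Disjoint A K → Θ A = 0

/-- The `i`-th component of an `ℝ^N`-valued measure. -/
noncomputable def component (Θ : VectorMeasure (Euc N) (Euc N)) (i : Fin N) :
    SignedMeasure (Euc N) :=
  Θ.mapRange (EuclideanSpace.proj i : Euc N →L[ℝ] ℝ).toLinearMap.toAddMonoidHom
    (EuclideanSpace.proj i : Euc N →L[ℝ] ℝ).continuous

/-- The Radon-Nikodym density `Θ / |Θ|`, taken component by component. -/
noncomputable def polar (Θ : VectorMeasure (Euc N) (Euc N)) (x : Euc N) : Euc N :=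
  WithLp.toLp 2 fun i => (component Θ i).rnDeriv Θ.variation x

/-- The positive measure `H(x, Θ) = H(x, Θ / |Θ|) |Θ|`. -/
noncomputable def metricMeasure (H : Euc N → Euc N → ℝ) (Θ : VectorMeasure (Euc N) (Euc N)) :
    Measure (Euc N) :=
  Θ.variation.withDensity fun x => ENNReal.ofReal (H x (polar Θ x))

/-- The integral `∫ f dμ` against a signed measure. -/
noncomputable def signedIntegral (μ : SignedMeasure (Euc N)) (f : Euc N → ℝ) : ℝ :=
  ∫ x, f x ∂μ.toJordanDecomposition.posPart - ∫ x, f x ∂μ.toJordanDecomposition.negPart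

/-! ### The tangential gradient with respect to a measure -/

/-- `σ ∈ L¹_γ(closure Ω, ℝ^N)` and the distribution `div (σ γ)` is a bounded Radon measure on the
closure of `Ω`. -/
def IsTangentField (Ω : Set (Euc N)) (γ : Measure (Euc N)) (σ : Euc N → Euc N) : Prop :=
  Integrable σ γ ∧ ∃ μ : SignedMeasure (Euc N), CarriedBy μ (closure Ω) ∧
    ∀ η : Euc N → ℝ, IsTestFunction univ η →
      ∫ x, ⟪σ x, gradient η x⟫_ℝ ∂γ = - signedIntegral μ η

/-- A family of subspaces, as a closed valued multifunction, is `γ`-measurable. -/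
def MeasurableFamily (γ : Measure (Euc N)) (X : Euc N → Submodule ℝ (Euc N)) : Prop :=
  ∀ y : Euc N, AEMeasurable (fun x => Metric.infDist y (X x : Set (Euc N))) γ

/-- `X` is the `γ`-essential union of the sets `{σ x}`, `σ` a tangent field: the `γ`-a.e. smallest
`γ`-measurable multifunction with `σ x ∈ X x` for `γ`-a.e. `x`, for each such `σ`. The tangent fields
form a vector space which is closed under multiplication by test functions, so that the essential
union has linear subspaces as its values. -/
structure IsTangentSpace (Ω : Set (Euc N)) (γ : Measure (Euc N))
    (X : Euc N → Submodule ℝ (Euc N)) : Prop where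
  measurable : MeasurableFamily γ X
  mem : ∀ σ, IsTangentField Ω γ σ → ∀ᵐ x ∂γ, σ x ∈ X x
  minimal : ∀ Y : Euc N → Submodule ℝ (Euc N), MeasurableFamily γ Y →
    (∀ σ, IsTangentField Ω γ σ → ∀ᵐ x ∂γ, σ x ∈ Y x) → ∀ᵐ x ∂γ, X x ≤ Y x

open Classical in
/-- The tangent space `𝒳_γ(x)` to the measure `γ` at `x`; the family is unique up to `γ`-null sets. -/
noncomputable def tangentSpace (Ω : Set (Euc N)) (γ : Measure (Euc N)) :
    Euc N → Submodule ℝ (Euc N) :=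
  if h : ∃ X, IsTangentSpace Ω γ X then h.choose else fun _ => ⊥

/-- `v = ∇_γ u`. For `w` of class `C¹` on the closure of `Ω` the tangential gradient is the orthogonal
projection of `∇w(x)` onto `𝒳_γ(x)`; it is extended to Lipschitz functions by continuity, from
uniform convergence of equi-Lipschitz sequences to weak-star convergence in `L^∞_γ`. -/
def IsTangentialGradient (Ω : Set (Euc N)) (γ : Measure (Euc N)) (u : Euc N → ℝ)
    (v : Euc N → Euc N) : Prop :=
  MemLp v ∞ γ ∧ ∃ (w : ℕ → Euc N → ℝ) (L : ℝ≥0),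
    (∀ n, ContDiff ℝ 1 (w n)) ∧
    (∀ n, LipschitzOnWith L (w n) (closure Ω)) ∧
    TendstoUniformlyOn w u atTop (closure Ω) ∧
    ∀ g : Euc N → Euc N, Integrable g γ →
      Tendsto
        (fun n => ∫ x, ⟪g x, (tangentSpace Ω γ x).starProjection (gradient (w n) x)⟫_ℝ ∂γ)
        atTop (𝓝 (∫ x, ⟪g x, v x⟫_ℝ ∂γ))

open Classical in
/-- The tangential gradient `∇_γ u`, which is unique up to `γ`-null sets. -/
noncomputable def tangentialGradient (Ω : Set (Euc N)) (γ : Measure (Euc N)) (u : Euc N → ℝ) :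
    Euc N → Euc N :=
  if h : ∃ v, IsTangentialGradient Ω γ u v then h.choose else 0

/-! ### The limiting equation -/

/-- `(u, Θ)` solves `-div Θ = ρ` in `Ω`, `Θ · ∇u = H(x, Θ)` in `Ω`, `φ ≤ u ≤ ψ` on `∂Ω`, with
normal trace `Θ · n = θ`. -/
structure IsSolutionWithTrace (Ω : Set (Euc N)) (H : Euc N → Euc N → ℝ)
    (φ ψ ρ u : Euc N → ℝ) (Θ : VectorMeasure (Euc N) (Euc N))
    (θ : SignedMeasure (Euc N)) : Prop where
  mem_sobolev : MemW1Infty Ω u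
  obstacle : ∀ x ∈ frontier Ω, φ x ≤ u x ∧ u x ≤ ψ x
  flow_carried : CarriedBy Θ Ω
  trace_carried : CarriedBy θ (frontier Ω)
  /-- `⟨Θ · n, η⟩ = ∫ ∇η · dΘ - ∫ η ρ dx`, that is, `-div Θ = ρ + θ` in `𝓓'(ℝ^N)`. -/
  normal_trace : ∀ η : Euc N → ℝ, IsTestFunction univ η →
    ∫ x, ⟪polar Θ x, gradient η x⟫_ℝ ∂Θ.variation
      = (∫ x in Ω, η x * ρ x) + signedIntegral θ η
  /-- `(Θ / |Θ|) · ∇_{|Θ|} u = H(x, Θ / |Θ|)`. -/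
  eikonal : ∀ᵐ x ∂Θ.variation,
    ⟪polar Θ x, tangentialGradient Ω Θ.variation u x⟫_ℝ = H x (polar Θ x)
  support_pos : θ.toJordanDecomposition.posPart.support ⊆ {x ∈ frontier Ω | u x = φ x}
  support_neg : θ.toJordanDecomposition.negPart.support ⊆ {x ∈ frontier Ω | u x = ψ x}
  /-- Integration by parts; `∇η` is taken in the tangential sense with respect to `|Θ|`. -/
  integration_by_parts : ∀ η : Euc N → ℝ, MemW1Infty Ω η →
    ∫ x, ⟪polar Θ x, tangentialGradient Ω Θ.variation η x⟫_ℝ ∂Θ.variation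
      = (∫ x in Ω, η x * ρ x) + signedIntegral θ η

/-- `(u, Θ)` solves the limiting equation: its normal trace is some bounded Radon measure on `∂Ω`. -/
def IsSolution (Ω : Set (Euc N)) (H : Euc N → Euc N → ℝ)
    (φ ψ ρ u : Euc N → ℝ) (Θ : VectorMeasure (Euc N) (Euc N)) : Prop :=
  ∃ θ : SignedMeasure (Euc N), IsSolutionWithTrace Ω H φ ψ ρ u Θ θ

end Finsler

namespace Finsler

/-! ### The dual metric -/

section Dual

variable {Ω : Set (Euc N)} {H : Euc N → Euc N → ℝ} {x p v : Euc N}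

/-! Write `p = Θ/|Θ|` and `f = H(x, p)`, so that `ω = f |Θ|`. Since `p ≠ 0` holds `|Θ|`-a.e., `f >
0` a.e. and `ω`, `|Θ|` have the same null sets. Tangent spaces and tangential gradients do not see
such a change of density (`tangentialGradient_withDensity`), so the equation reads `⟪p, v⟫ = H(x,
p)` with `v = ∇_ω u`. This is the equality case of `⟪p, q⟫ ≤ H(x, p) H*(x, q)`. With `H*(x, v) ≤ 1`
it forces `H*(x, v) = 1`, and first-order optimality in `q` at `v` gives `∂_ξ H*(x, v) = p / f`.
Multiplying by `ω = f |Θ|` yields `p |Θ| = Θ`. -/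

theorem IsNondegenerateFinsler.pos (hH : IsNondegenerateFinsler Ω H) (hx : x ∈ closure Ω)
    (hp : p ≠ 0) : 0 < H x p := by
  obtain ⟨a, b, ha, -, h⟩ := hH.nondegenerate
  exact (mul_pos ha (norm_pos_iff.2 hp)).trans_le (h x hx p).1

theorem IsNondegenerateFinsler.bddAbove_dual (hH : IsNondegenerateFinsler Ω H)
    (hx : x ∈ closure Ω) (q : Euc N) :
    BddAbove {r : ℝ | ∃ p : Euc N, H x p ≤ 1 ∧ r = ⟪p, q⟫_ℝ} := by
  obtain ⟨a, b, ha, -, h⟩ := hH.nondegenerate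
  refine ⟨1 / a * ‖q‖, ?_⟩
  rintro r ⟨p, hp, rfl⟩
  have hpa : ‖p‖ ≤ 1 / a := by
    rw [le_div_iff₀' ha]
    exact (h x hx p).1.trans hp
  exact (real_inner_le_norm p q).trans (by gcongr)

/-- The generalized Cauchy-Schwarz inequality for a metric and its dual. -/
theorem IsNondegenerateFinsler.inner_le_mul_dual (hH : IsNondegenerateFinsler Ω H)
    (hx : x ∈ closure Ω) (p q : Euc N) : ⟪p, q⟫_ℝ ≤ H x p * dual H x q := by
  rcases eq_or_ne p 0 with rfl | hp
  · have h0 : H x 0 = 0 := by simpa using hH.homogeneous x hx 0 le_rfl 0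
    simp [h0]
  have hpos := hH.pos hx hp
  have hle : ⟪(H x p)⁻¹ • p, q⟫_ℝ ≤ dual H x q := by
    refine le_csSup (hH.bddAbove_dual hx q) ⟨_, ?_, rfl⟩
    rw [hH.homogeneous x hx _ (inv_nonneg.2 hpos.le), inv_mul_cancel₀ hpos.ne']
  rw [real_inner_smul_left, inv_mul_le_iff₀ hpos] at hle
  exact hle

/-- In the equality case of the generalized Cauchy-Schwarz inequality, `q` is on the dual unit
sphere. -/
theorem IsNondegenerateFinsler.dual_eq_one (hH : IsNondegenerateFinsler Ω H)
    (hx : x ∈ closure Ω) (hp : p ≠ 0) (heq : ⟪p, v⟫_ℝ = H x p) (hv : dual H x v ≤ 1) :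
    dual H x v = 1 := by
  have hpos := hH.pos hx hp
  have hle := hH.inner_le_mul_dual hx p v
  rw [heq] at hle
  exact hv.antisymm (le_of_mul_le_mul_left (by simpa using hle) hpos)

/-- In the equality case of the generalized Cauchy-Schwarz inequality, the gradient of the dual
metric is the normalized vector. -/
theorem IsNondegenerateFinsler.gradient_dual (hH : IsNondegenerateFinsler Ω H)
    (hx : x ∈ closure Ω) (hdiff : ContDiffOn ℝ 1 (dual H x) {0}ᶜ) (hp : p ≠ 0)
    (heq : ⟪p, v⟫_ℝ = H x p) (hv : dual H x v = 1) :
    gradient (dual H x) v = (H x p)⁻¹ • p := by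
  have hpos := hH.pos hx hp
  -- Differentiability of the dual metric is only available away from the origin.
  have hv0 : v ≠ 0 := by
    rintro rfl
    rw [inner_zero_right] at heq
    exact hpos.ne heq
  have hd : DifferentiableAt ℝ (dual H x) v :=
    (hdiff.differentiableOn one_ne_zero).differentiableAt (isOpen_compl_singleton.mem_nhds hv0)
  set e : Euc N := (H x p)⁻¹ • p
  -- This difference is nonnegative everywhere, and it is `1 - 1 = 0` at `v`.
  have hmin : IsLocalMin (fun q => dual H x q - ⟪e, q⟫_ℝ) v := by
    refine Filter.Eventually.of_forall fun q => ?_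
    have h1 : ⟪e, v⟫_ℝ = 1 := by
      rw [real_inner_smul_left, heq, inv_mul_cancel₀ hpos.ne']
    have h2 : ⟪e, q⟫_ℝ ≤ dual H x q := by
      rw [real_inner_smul_left, inv_mul_le_iff₀ hpos]
      exact hH.inner_le_mul_dual hx p q
    simp only [h1, hv]
    linarith
  have hf := hmin.hasFDerivAt_eq_zero (hd.hasFDerivAt.sub (innerSL ℝ e).hasFDerivAt)
  rw [sub_eq_zero] at hf
  rw [gradient, hf]
  exact (InnerProductSpace.toDual ℝ (Euc N)).symm_apply_eq.2 rfl

end Dual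

/-! ### Total variation and polar decomposition -/

section Polar

variable (Θ : VectorMeasure (Euc N) (Euc N))

theorem component_apply (i : Fin N) (A : Set (Euc N)) : component Θ i A = Θ A i := rfl

/-- The norm of a vector is at most the sum of its absolute coordinates, and each coordinate is a
finite signed measure. Finiteness gives the σ-finiteness that Radon-Nikodym requires. -/
instance isFiniteMeasure_variation : IsFiniteMeasure Θ.variation := by
  have hle : Θ.variation ≤ ∑ i, (component Θ i).totalVariation := by
    refine VectorMeasure.variation_le_of_forall_enorm_le fun E _ => ?_
    rw [Measure.finsetSum_apply]
    have hsum : Θ E = ∑ i, EuclideanSpace.single i (Θ E i) := by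
      ext j
      simp
    calc ‖Θ E‖ₑ = ‖∑ i, EuclideanSpace.single i (Θ E i)‖ₑ := by rw [← hsum]
      _ ≤ ∑ i, ‖EuclideanSpace.single i (Θ E i)‖ₑ := enorm_sum_le _ _
      _ ≤ ∑ i, (component Θ i).totalVariation E := by
        refine Finset.sum_le_sum fun i _ => ?_
        have h := SignedMeasure.enorm_le_totalVariation (component Θ i) E
        rw [component_apply] at h
        refine le_trans (le_of_eq ?_) h
        rw [← ofReal_norm, ← ofReal_norm, PiLp.norm_single]
  exact isFiniteMeasure_of_le _ hle

theorem measurable_polar : Measurable (polar Θ) :=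
  (PiLp.continuous_toLp 2 _).measurable.comp
    (measurable_pi_lambda _ fun i => SignedMeasure.measurable_rnDeriv (component Θ i) Θ.variation)

theorem integrable_polar : Integrable (polar Θ) Θ.variation :=
  Integrable.of_eval_piLp fun i => SignedMeasure.integrable_rnDeriv (component Θ i) Θ.variation

theorem withDensity_polar : Θ.variation.withDensityᵥ (polar Θ) = Θ := by
  ext A hA i
  rw [withDensityᵥ_apply (integrable_polar Θ) hA,
    eval_integral_piLp fun i => ((integrable_polar Θ).eval_piLp i).restrict]
  have hac : component Θ i ≪ᵥ Θ.variation.toENNRealVectorMeasure := by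
    refine VectorMeasure.AbsolutelyContinuous.mk fun s hs h => ?_
    rw [Measure.toENNRealVectorMeasure_apply_measurable hs] at h
    rw [component_apply, (VectorMeasure.variation_apply_eq_zero hs).1 h s subset_rfl hs]
    rfl
  have h := congrArg (fun s : SignedMeasure (Euc N) => s A)
    (SignedMeasure.withDensityᵥ_rnDeriv_eq (component Θ i) Θ.variation hac)
  simp only [component_apply] at h
  rw [withDensityᵥ_apply (SignedMeasure.integrable_rnDeriv _ _) hA] at h
  exact h

/-- By `withDensity_polar`, `Θ` vanishes on every measurable subset of `{polar Θ = 0}`, so its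
variation does too. -/
theorem polar_ne_zero : ∀ᵐ x ∂Θ.variation, polar Θ x ≠ 0 := by
  have hm : MeasurableSet {x | polar Θ x = 0} := measurable_polar Θ (measurableSet_singleton 0)
  rw [ae_iff]
  simp only [ne_eq, not_not]
  rw [VectorMeasure.variation_apply_eq_zero hm]
  intro t ht htm
  rw [← withDensity_polar Θ, withDensityᵥ_apply (integrable_polar Θ) htm]
  exact setIntegral_eq_zero_of_forall_eq_zero fun x hx => ht hx

theorem ae_mem_of_carriedBy {Θ : VectorMeasure (Euc N) (Euc N)} {K : Set (Euc N)}
    (hK : MeasurableSet K) (h : CarriedBy Θ K) : ∀ᵐ x ∂Θ.variation, x ∈ K := by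
  rw [ae_iff]
  refine (VectorMeasure.variation_apply_eq_zero hK.compl).2 fun t ht htm => h t htm ?_
  exact Set.disjoint_left.2 fun x hx => ht hx

end Polar

/-! ### Tangential gradients with respect to equivalent measures -/

section Density

variable {Ω : Set (Euc N)} {μ : Measure (Euc N)} {f : Euc N → ℝ≥0}

theorem IsTangentField.congr {γ : Measure (Euc N)} {σ τ : Euc N → Euc N} (h : σ =ᵐ[γ] τ)
    (hσ : IsTangentField Ω γ σ) : IsTangentField Ω γ τ := by
  obtain ⟨hi, ν, hν, hη⟩ := hσ
  refine ⟨hi.congr h, ν, hν, fun η h' => ?_⟩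
  rw [← hη η h']
  refine integral_congr_ae ?_
  filter_upwards [h] with x hx
  rw [hx]

/-- Only the product `σ γ` enters the definition, and `σ (f μ) = (f σ) μ`. -/
theorem isTangentField_withDensity_iff (hf : AEMeasurable f μ) (σ : Euc N → Euc N) :
    IsTangentField Ω (μ.withDensity fun x => f x) σ ↔
      IsTangentField Ω μ fun x => f x • σ x := by
  unfold IsTangentField
  rw [integrable_withDensity_iff_integrable_smul₀ hf]
  simp only [integral_withDensity_eq_integral_smul₀ hf, NNReal.smul_def, real_inner_smul_left,
    smul_eq_mul]

theorem ae_withDensity_iff_ae (hf : AEMeasurable f μ) (hf0 : ∀ᵐ x ∂μ, f x ≠ 0)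
    {P : Euc N → Prop} :
    (∀ᵐ x ∂μ.withDensity fun x => (f x : ℝ≥0∞), P x) ↔ ∀ᵐ x ∂μ, P x :=
  ⟨fun h => (withDensity_absolutelyContinuous' hf.coe_nnreal_ennreal (by simpa using hf0)).ae_le h,
    fun h => (withDensity_absolutelyContinuous μ _).ae_le h⟩

theorem aemeasurable_withDensity_iff {β : Type*} [MeasurableSpace β] (hf : AEMeasurable f μ)
    (hf0 : ∀ᵐ x ∂μ, f x ≠ 0) {g : Euc N → β} :
    AEMeasurable g (μ.withDensity fun x => (f x : ℝ≥0∞)) ↔ AEMeasurable g μ :=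
  ⟨fun h => h.mono_ac
      (withDensity_absolutelyContinuous' hf.coe_nnreal_ennreal (by simpa using hf0)),
    fun h => h.mono_ac (withDensity_absolutelyContinuous μ _)⟩

/-- Tangent fields correspond under `σ ↦ f σ`, and a linear subspace is stable under scaling by `f
x` and its inverse. -/
theorem forall_isTangentField_withDensity_iff (hf : AEMeasurable f μ)
    (hf0 : ∀ᵐ x ∂μ, f x ≠ 0) (Y : Euc N → Submodule ℝ (Euc N)) :
    (∀ σ, IsTangentField Ω (μ.withDensity fun x => f x) σ →
        ∀ᵐ x ∂μ.withDensity fun x => (f x : ℝ≥0∞), σ x ∈ Y x) ↔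
      ∀ σ, IsTangentField Ω μ σ → ∀ᵐ x ∂μ, σ x ∈ Y x := by
  simp only [ae_withDensity_iff_ae hf hf0, isTangentField_withDensity_iff hf]
  constructor
  · intro h σ hσ
    have hcongr : σ =ᵐ[μ] fun x => f x • (f x)⁻¹ • σ x := by
      filter_upwards [hf0] with x hx
      rw [smul_inv_smul₀ hx]
    filter_upwards [h _ (hσ.congr hcongr), hf0] with x hx hx0
    have := (Y x).smul_mem (f x : ℝ) hx
    rwa [← NNReal.smul_def, smul_inv_smul₀ hx0] at this
  · intro h σ hσ
    filter_upwards [h _ hσ, hf0] with x hx hx0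
    have := (Y x).smul_mem ((f x)⁻¹ : ℝ) hx
    rwa [← NNReal.coe_inv, ← NNReal.smul_def, inv_smul_smul₀ hx0] at this

/-- The two defining predicates are equal, so `choose` picks the same family: the equality is
pointwise, with no appeal to existence or uniqueness. -/
theorem tangentSpace_withDensity (hf : AEMeasurable f μ) (hf0 : ∀ᵐ x ∂μ, f x ≠ 0) :
    tangentSpace Ω (μ.withDensity fun x => f x) = tangentSpace Ω μ := by
  have hM : MeasurableFamily (μ.withDensity fun x => (f x : ℝ≥0∞)) = MeasurableFamily μ := by
    funext Y
    simp only [MeasurableFamily, aemeasurable_withDensity_iff hf hf0]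
  have hT : IsTangentSpace Ω (μ.withDensity fun x => (f x : ℝ≥0∞)) = IsTangentSpace Ω μ := by
    funext X
    refine propext ⟨fun h => ⟨hM ▸ h.measurable, ?_, fun Y hY hY' => ?_⟩,
      fun h => ⟨hM ▸ h.measurable, ?_, fun Y hY hY' => ?_⟩⟩
    · exact (forall_isTangentField_withDensity_iff hf hf0 X).1 h.mem
    · exact (ae_withDensity_iff_ae hf hf0).1 (h.minimal Y (hM ▸ hY)
        ((forall_isTangentField_withDensity_iff hf hf0 Y).2 hY'))
    · exact (forall_isTangentField_withDensity_iff hf hf0 X).2 h.mem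
    · exact (ae_withDensity_iff_ae hf hf0).2 (h.minimal Y (hM ▸ hY)
        ((forall_isTangentField_withDensity_iff hf hf0 Y).1 hY'))
  unfold tangentSpace
  rw [hT]

theorem memLp_top_withDensity_iff (hf : AEMeasurable f μ) (hf0 : ∀ᵐ x ∂μ, f x ≠ 0)
    {v : Euc N → Euc N} :
    MemLp v ∞ (μ.withDensity fun x => (f x : ℝ≥0∞)) ↔ MemLp v ∞ μ := by
  have h1 := withDensity_absolutelyContinuous' hf.coe_nnreal_ennreal (by simpa using hf0)
  have h2 := withDensity_absolutelyContinuous μ fun x => (f x : ℝ≥0∞)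
  have h : eLpNormEssSup v (μ.withDensity fun x => (f x : ℝ≥0∞)) = eLpNormEssSup v μ :=
    le_antisymm (eLpNormEssSup_mono_measure v h2) (eLpNormEssSup_mono_measure v h1)
  simp only [MemLp, eLpNorm_exponent_top, h]
  exact and_congr_left fun _ => ⟨fun h => h.mono_ac h1, fun h => h.mono_ac h2⟩

theorem tangentialGradient_withDensity (hf : AEMeasurable f μ) (hf0 : ∀ᵐ x ∂μ, f x ≠ 0)
    (u : Euc N → ℝ) :
    tangentialGradient Ω (μ.withDensity fun x => f x) u = tangentialGradient Ω μ u := by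
  have hG : IsTangentialGradient Ω (μ.withDensity fun x => (f x : ℝ≥0∞)) u =
      IsTangentialGradient Ω μ u := by
    funext v
    unfold IsTangentialGradient
    simp only [tangentSpace_withDensity hf hf0, memLp_top_withDensity_iff hf hf0,
      integrable_withDensity_iff_integrable_smul₀ hf, integral_withDensity_eq_integral_smul₀ hf]
    refine propext (and_congr_right fun _ => exists_congr fun w => exists_congr fun L =>
      and_congr_right fun _ => and_congr_right fun _ => and_congr_right fun _ => ?_)
    simp only [NNReal.smul_def, smul_eq_mul, ← real_inner_smul_left]
    constructor
    -- Testing against `g` under `μ` is testing against `f⁻¹ g` under `f μ`.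
    · intro h g hg
      have hcongr : ∀ᵐ x ∂μ, (f x : ℝ) • (f x : ℝ)⁻¹ • g x = g x := by
        filter_upwards [hf0] with x hx
        rw [smul_inv_smul₀ (NNReal.coe_ne_zero.2 hx)]
      have hint : ∀ k : Euc N → Euc N,
          ∫ x, ⟪(f x : ℝ) • (f x : ℝ)⁻¹ • g x, k x⟫_ℝ ∂μ = ∫ x, ⟪g x, k x⟫_ℝ ∂μ := by
        intro k
        refine integral_congr_ae ?_
        filter_upwards [hcongr] with x hx
        rw [hx]
      have := h (fun x => (f x : ℝ)⁻¹ • g x) (hg.congr (hcongr.mono fun x hx => hx.symm))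
      simpa only [hint] using this
    · exact fun h g hg => h _ hg
  unfold tangentialGradient
  rw [hG]

end Density

/-! ### The metric measure of a flow -/

theorem IsNondegenerateFinsler.aemeasurable_comp {Ω : Set (Euc N)} {H : Euc N → Euc N → ℝ}
    (hH : IsNondegenerateFinsler Ω H) {μ : Measure (Euc N)} (hμ : ∀ᵐ x ∂μ, x ∈ closure Ω)
    {p : Euc N → Euc N} (hp : Measurable p) : AEMeasurable (fun x => H x (p x)) μ := by
  classical
  have hS : MeasurableSet (closure Ω ×ˢ (univ : Set (Euc N))) :=
    isClosed_closure.measurableSet.prod MeasurableSet.univ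
  -- `H` is controlled only over the closure of `Ω`, so it is replaced by zero elsewhere, a change
  -- on a `μ`-null set of `x`.
  have hm := hH.continuousOn.measurable_piecewise
    (continuousOn_const (c := (0 : ℝ)) (s := (closure Ω ×ˢ (univ : Set (Euc N)))ᶜ)) hS
  refine ⟨_, hm.comp (measurable_id.prodMk hp), ?_⟩
  filter_upwards [hμ] with x hx
  simp [Set.piecewise, hx]

end Finsler

theorem mainTheorem8 (N : ℕ) (Ω : Set (Finsler.Euc N))
    (hΩ : Finsler.IsSmoothBoundedDomain Ω)
    (H : Finsler.Euc N → Finsler.Euc N → ℝ)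
    (hH : Finsler.IsNondegenerateFinsler Ω H)
    (hdual : ∀ x ∈ closure Ω, ContDiffOn ℝ 1 (Finsler.dual H x) {0}ᶜ)
    (φ ψ ρ : Finsler.Euc N → ℝ)
    (hφ : ContinuousOn φ (frontier Ω)) (hψ : ContinuousOn ψ (frontier Ω))
    (hρ : MemLp ρ 2 (volume.restrict Ω))
    (u : Finsler.Euc N → ℝ) (Θ : VectorMeasure (Finsler.Euc N) (Finsler.Euc N))
    (hsol : Finsler.IsSolution Ω H φ ψ ρ u Θ)
    (ω : Measure (Finsler.Euc N)) (hω : ω = Finsler.metricMeasure H Θ)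
    (hsub : ∀ᵐ x ∂ω, Finsler.dual H x (Finsler.tangentialGradient Ω ω u x) ≤ 1) :
    (Integrable (fun x => gradient (Finsler.dual H x) (Finsler.tangentialGradient Ω ω u x)) ω ∧
      Θ = ω.withDensityᵥ
        (fun x => gradient (Finsler.dual H x) (Finsler.tangentialGradient Ω ω u x))) ∧
    ∀ᵐ x ∂ω, Finsler.dual H x (Finsler.tangentialGradient Ω ω u x) = 1 := by
  obtain ⟨θ, hθ⟩ := hsol
  set μ := Θ.variation
  set p := Finsler.polar Θ
  set v := Finsler.tangentialGradient Ω ω u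
  set f : Finsler.Euc N → ℝ≥0 := fun x => (H x (p x)).toNNReal
  have hmem : ∀ᵐ x ∂μ, x ∈ closure Ω :=
    (Finsler.ae_mem_of_carriedBy hΩ.isOpen.measurableSet hθ.flow_carried).mono
      fun x hx => subset_closure hx
  have hp0 : ∀ᵐ x ∂μ, p x ≠ 0 := Finsler.polar_ne_zero Θ
  have hf : AEMeasurable f μ :=
    (hH.aemeasurable_comp hmem (Finsler.measurable_polar Θ)).real_toNNReal
  have hf0 : ∀ᵐ x ∂μ, f x ≠ 0 := by
    filter_upwards [hmem, hp0] with x hx hpx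
    exact (Real.toNNReal_pos.2 (hH.pos hx hpx)).ne'
  have hωf : ω = μ.withDensity fun x => (f x : ℝ≥0∞) := hω
  have hv : v = Finsler.tangentialGradient Ω μ u := by
    simp only [v, hωf]
    exact Finsler.tangentialGradient_withDensity hf hf0 u
  have hsubμ : ∀ᵐ x ∂μ, Finsler.dual H x (v x) ≤ 1 := by
    rw [hωf] at hsub
    exact (Finsler.ae_withDensity_iff_ae hf hf0).1 hsub
  have heik : ∀ᵐ x ∂μ, ⟪p x, v x⟫_ℝ = H x (p x) := hv ▸ hθ.eikonal
  have hone : ∀ᵐ x ∂μ, Finsler.dual H x (v x) = 1 := by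
    filter_upwards [hmem, hp0, heik, hsubμ] with x hx hpx he hs
    exact hH.dual_eq_one hx hpx he hs
  -- The density `f = H(x, p)` cancels the normalization in `∂_ξ H*(x, v) = p / H(x, p)`.
  have hsmul : (f • fun x => gradient (Finsler.dual H x) (v x)) =ᵐ[μ] p := by
    filter_upwards [hmem, hp0, heik, hone] with x hx hpx he h1
    have hpos := hH.pos hx hpx
    rw [Pi.smul_apply', hH.gradient_dual hx (hdual x hx) hpx he h1, NNReal.smul_def,
      Real.coe_toNNReal _ hpos.le, smul_inv_smul₀ hpos.ne']
  have hint : Integrable (f • fun x => gradient (Finsler.dual H x) (v x)) μ :=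
    (Finsler.integrable_polar Θ).congr hsmul.symm
  rw [hωf]
  refine ⟨⟨(integrable_withDensity_iff_integrable_smul₀ hf).2 hint, ?_⟩,
    (Finsler.ae_withDensity_iff_ae hf hf0).2 hone⟩
  rw [← withDensityᵥ_smul_eq_withDensityᵥ_withDensity hf hint, WithDensityᵥEq.congr_ae hsmul]
  exact (Finsler.withDensity_polar Θ).symm
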